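/- A rooted plane tree is a finite rooted tree in which the children of every vertex are ordered from left to right. For odd $n$ let $\mathcal{B}_n$ be the (finite) family of all plane binary trees with $n$ vertices, that is, rooted plane trees in which every vertex has $0$ or $2$ children. Regard a rooted plane tree as a poset whose maximal element is the root (ancestors are larger than their descendants). An embedding of a rooted plane tree $S$ into a rooted plane tree $T$ is a subposet of $T$ (a set of vertices of $T$ with the induced order) that is isomorphic to $S$ in such a way that the left-to-right order of the children of each vertex of $S$ is the one inherited from $T$; it is good if it contains the root of $T$. Let $a_T(S)$ and $g_T(S)$ be the numbers of all embeddings and of good embeddings of $S$ into $T$, and put $a_{\mathcal{B}_n}(S)=\sum_{T\in\mathcal{B}_n}a_T(S)$ and $g_{\mathcal{B}_n}(S)=\sum_{T\in\mathcal{B}_n}g_T(S)$. **Corollary.** Let $S$ be a rooted plane tree with $m\ge 1$ vertices and $l$ leaves, and let $k=\frac{m+l-2}{2}$. Then, as $n\to\infty$ through the odd integers, $$ \frac{g_{\mathcal{B}_n}(S)}{a_{\mathcal{B}_n}(S)}\sim \begin{cases} \dfrac{\Gamma(k+1/2)}{\Gamma(k)}\,\dfrac{\sqrt2}{\sqrt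 n} & \text{if } k>0,\\[2mm] \dfrac1n & \text{if } k=0, \end{cases} $$ where $f(n)\sim h(n)$ means $f(n)/h(n)\to 1$. In particular, for $k>0$ the ratio is of order $\Theta(1/\sqrt n)$ along odd $n$. (The case $k=0$ occurs exactly when $S$ is a single vertex, a vertex without children being counted as a leaf.) -/

import Mathlib

open Filter Asymptotics

/-- Finite rooted plane trees: a root together with the left-to-right list of the subtrees
of its children. -/
inductive PlaneTree : Type
  | node : List PlaneTree → PlaneTree

namespace PlaneTree

/-- The number of vertices. -/
def size : PlaneTree → ℕ
  | node ts => 1 + (ts.map size).sum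

/-- The entry `d_i` of the degree distribution sequence: the number of vertices with exactly `i`
children. In particular `degreeCount 0` is the number of leaves. -/
def degreeCount (i : ℕ) : PlaneTree → ℕ
  | node ts => (if ts.length = i then 1 else 0) + (ts.map (degreeCount i)).sum

/-- A vertex is addressed by the list of the (0-based) child indices on the path from the root to
it; the root has the address `[]`. -/
def IsVertex : PlaneTree → List ℕ → Prop
  | _, [] => True
  | node ts, i :: p => ∃ h : i < ts.length, IsVertex ts[i] p

/-- The vertex set of a plane tree. The vertex `p` is `q` or an ancestor of `q` exactly if `p` is a
prefix of `q`; this is the order of the tree as a poset with the root as its maximal element. -/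
def vertices (T : PlaneTree) : Set (List ℕ) := {p | T.IsVertex p}

/-- `p` lies strictly to the left of `q`: for some vertex `r`, the vertices `p` and `q` are in the
subtrees of two different children of `r`, that of `p` being further left. -/
def LeftOf (p q : List ℕ) : Prop :=
  ∃ (r : List ℕ) (a b : ℕ), a < b ∧ (r ++ [a]) <+: p ∧ (r ++ [b]) <+: q

/-- `U` is (the vertex set of) an embedding of `S` into `T`: a subposet of `T`, with the order
induced by `T`, which is isomorphic to `S` by an isomorphism under which the left-to-right order of
the children of each vertex of `S` is the one inherited from `T`. -/
def IsEmbedding (S T : PlaneTree) (U : Set (List ℕ)) : Prop :=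
  U ⊆ T.vertices ∧
    ∃ f : S.vertices ≃ U,
      (∀ p q : S.vertices, (p : List ℕ) <+: q ↔ (f p : List ℕ) <+: f q) ∧
      ∀ (p : List ℕ) (i j : ℕ) (hi : p ++ [i] ∈ S.vertices) (hj : p ++ [j] ∈ S.vertices),
        i < j → LeftOf (f ⟨p ++ [i], hi⟩) (f ⟨p ++ [j], hj⟩)

/-- `a_T(S)`, the number of embeddings of `S` into `T`. -/
noncomputable def numEmbeddings (T S : PlaneTree) : ℕ :=
  {U : Set (List ℕ) | IsEmbedding S T U}.ncard

/-- `g_T(S)`, the number of good embeddings of `S` into `T`: those that contain the root of `T`. -/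
noncomputable def numGoodEmbeddings (T S : PlaneTree) : ℕ :=
  {U : Set (List ℕ) | IsEmbedding S T U ∧ [] ∈ U}.ncard

/-- Plane binary trees: every vertex has either no child or exactly two children. -/
inductive IsBinary : PlaneTree → Prop
  | leaf : IsBinary (node [])
  | branch (L R : PlaneTree) : IsBinary L → IsBinary R → IsBinary (node [L, R])

theorem size_node (ts : List PlaneTree) : (node ts).size = 1 + (ts.map size).sum := by
  rw [size]

theorem vertices_finite : ∀ T : PlaneTree, T.vertices.Finite
  | node ts => by
    have h : ∀ i : Fin ts.length, (ts[i]).vertices.Finite := fun i => vertices_finite ts[i]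
    refine ((Set.finite_singleton ([] : List ℕ)).union
      (Set.finite_iUnion fun i : Fin ts.length => (h i).image (List.cons (i : ℕ)))).subset ?_
    rintro (_ | ⟨i, p⟩) hp
    · exact Or.inl rfl
    · obtain ⟨hi, hp⟩ := hp
      exact Or.inr (Set.mem_iUnion.2 ⟨⟨i, hi⟩, p, hp, rfl⟩)
termination_by T => sizeOf T
decreasing_by
  have := List.sizeOf_lt_of_mem (List.getElem_mem i.2)
  simp only [node.sizeOf_spec, Fin.getElem_fin]
  omega

/-- So `numEmbeddings` and `numGoodEmbeddings` count finite sets. -/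
theorem embeddings_finite (S T : PlaneTree) : {U : Set (List ℕ) | IsEmbedding S T U}.Finite :=
  T.vertices_finite.finite_subsets.subset fun _ hU => hU.1

theorem finite_binary (n : ℕ) : {T : PlaneTree | T.IsBinary ∧ T.size = n}.Finite := by
  suffices h : ∀ n : ℕ, {T : PlaneTree | T.IsBinary ∧ T.size < n}.Finite from
    (h (n + 1)).subset fun T hT => ⟨hT.1, by have := hT.2; omega⟩
  intro n
  induction n with
  | zero => exact Set.finite_empty.subset fun T hT => absurd hT.2 (Nat.not_lt_zero _)
  | succ n ih =>
    refine ((Set.finite_singleton (node [])).union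
      (Set.Finite.image2 (fun L R => node [L, R]) ih ih)).subset ?_
    rintro T ⟨hT, hs⟩
    cases hT with
    | leaf => exact Or.inl rfl
    | branch L R hL hR =>
      simp only [size_node, List.map_cons, List.map_nil, List.sum_cons, List.sum_nil] at hs
      exact Or.inr ⟨L, ⟨hL, by omega⟩, R, ⟨hR, by omega⟩, rfl⟩

/-- The family `B_n` of all plane binary trees with `n` vertices. -/
noncomputable def binaryTrees (n : ℕ) : Finset PlaneTree := (finite_binary n).toFinset

/-- The total number of embeddings of `S` into the members of `B_n`. -/
noncomputable def allCount (n : ℕ) (S : PlaneTree) : ℕ :=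
  ∑ T ∈ binaryTrees n, numEmbeddings T S

/-- The total number of good embeddings of `S` into the members of `B_n`. -/
noncomputable def goodCount (n : ℕ) (S : PlaneTree) : ℕ :=
  ∑ T ∈ binaryTrees n, numGoodEmbeddings T S

end PlaneTree

/-!
For a forest `F` let `A_F` and `G_F` be the generating functions, with respect to the number of
internal vertices of a binary tree, of the copies of `F` in binary trees and of those copies that
avoid the root. A good embedding of `S = node F` is a copy of `F` that avoids the root together with
the root, so `A_[S]` and `G_F` count all and good embeddings of `S`.

A copy that avoids the root of a binary tree is cut into two consecutive parts by the two subtrees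
of the root, so `G_F = X ∑ A_G A_H` over the splittings `F = G ++ H` of a nonempty `F`. Put
`s = √(1 - 4X)`. The two trivial splittings contribute `2 X A_[] A_F = (1 - s) A_F`, and a copy of a
single tree may also use the root; hence `s A_[S] = G_F`, and `U_F = X A_F / s` satisfies
`U_F = ∑ U_G U_H` over the proper splittings if `F` has at least two trees. So `U_F` is a Catalan
number times the product of `U_[t]` over the trees `t` of `F`. By induction on `S`, `U_[S]` is then
a positive multiple of `(1 - s) ^ c / s ^ (m + l)` for some `c`, where the factor `(1 - s) ^ c` does
not affect the leading singularity. The theorem follows from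
`[Xⁿ] (1 - 4X) ^ (-r) ∼ 4ⁿ nʳ⁻¹ / Γ(r)` with `r = k` for `X G_F` and `r = k + 1/2` for `X A_[S]`.
-/

open scoped Topology PowerSeries

section NegBinomialSeries

open PowerSeries

variable {R : Type*} [CommRing R] [BinomialRing R]

/-- The formal power series `(1 - bX) ^ (-r)`. -/
noncomputable def negBinomialSeries (b r : R) : R⟦X⟧ :=
  rescale (-b) (binomialSeries R (-r))

theorem coeff_negBinomialSeries (b r : R) (n : ℕ) :
    coeff n (negBinomialSeries b r) = b ^ n * Ring.multichoose r n := by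
  rw [negBinomialSeries, coeff_rescale, binomialSeries_coeff, Ring.choose_neg', Int.negOnePow_def,
    neg_pow, smul_eq_mul, mul_one, Units.smul_def, zsmul_eq_mul]
  rcases n.even_or_odd with hn | hn <;> simp [hn.neg_one_pow]

theorem negBinomialSeries_add (b r s : R) :
    negBinomialSeries b (r + s) = negBinomialSeries b r * negBinomialSeries b s := by
  rw [negBinomialSeries, neg_add, binomialSeries_add, map_mul, negBinomialSeries,
    negBinomialSeries]

theorem negBinomialSeries_zero (b : R) : negBinomialSeries b 0 = 1 := by
  rw [negBinomialSeries, neg_zero, binomialSeries_zero, map_one]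

theorem negBinomialSeries_neg_one (b : R) : negBinomialSeries b (-1) = 1 - C b * X := by
  have h := binomialSeries_nat (R := R) (A := R) 1
  rw [Nat.cast_one, pow_one] at h
  rw [negBinomialSeries, neg_neg, h, map_add, map_one, rescale_X, map_neg, neg_mul, sub_eq_add_neg]

theorem constantCoeff_negBinomialSeries (b r : R) :
    constantCoeff (negBinomialSeries b r) = 1 := by
  rw [← coeff_zero_eq_constantCoeff_apply, coeff_negBinomialSeries, pow_zero,
    Ring.multichoose_zero_right, one_mul]

end NegBinomialSeries

theorem powerSeries_eq_of_sq_eq_sq {R : Type*} [CommRing R] [IsDomain R] {f g : R⟦X⟧}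
    (h : f ^ 2 = g ^ 2) (hconst : f.constantCoeff ≠ -g.constantCoeff) : f = g := by
  refine (sq_eq_sq_iff_eq_or_eq_neg.1 h).resolve_right fun hneg => hconst ?_
  rw [hneg, map_neg]

theorem catalan_pos (n : ℕ) : 0 < catalan n :=
  Nat.pos_of_mul_pos_left (succ_mul_catalan_eq_centralBinom n ▸ n.centralBinom_pos)

/-- `catalan (F.length - 1)` counts the bracketings of `F`. -/
theorem eq_catalan_mul_prod_of_eq_sum_splits {α R : Type*} [CommSemiring R] {u : List α → R}
    (hu : ∀ F : List α, 2 ≤ F.length →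
      u F = ∑ i ∈ Finset.range (F.length - 1), u (F.take (i + 1)) * u (F.drop (i + 1)))
    {F : List α} (hF : F ≠ []) :
    u F = catalan (F.length - 1) * (F.map fun a => u [a]).prod := by
  induction hn : F.length using Nat.strong_induction_on generalizing F with
  | _ n ih =>
  subst hn
  match F with
  | [a] => simp
  | a :: b :: G =>
    have hsplit : ∀ i ∈ Finset.range (G.length + 1),
        u ((a :: b :: G).take (i + 1)) * u ((a :: b :: G).drop (i + 1)) =
          (catalan i * catalan (G.length - i) : ℕ) * ((a :: b :: G).map fun a => u [a]).prod := by
      intro i hi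
      have hi := Finset.mem_range.1 hi
      rw [ih _ (by grind) (by grind) rfl, ih _ (by grind) (by grind) rfl]
      nth_rw 5 [← List.take_append_drop (i + 1) (a :: b :: G)]
      rw [List.map_append, List.prod_append, List.length_take, List.length_drop, Nat.cast_mul,
        show min (i + 1) (a :: b :: G).length - 1 = i by grind,
        show (a :: b :: G).length - (i + 1) - 1 = G.length - i by grind]
      ring
    rw [hu _ (by simp), show (a :: b :: G).length - 1 = G.length + 1 by simp,
      Finset.sum_congr rfl hsplit, ← Finset.sum_mul, ← Nat.cast_sum, catalan_succ',
      Finset.Nat.sum_antidiagonal_eq_sum_range_succ fun i j => catalan i * catalan j]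

section SingularExponent

open PowerSeries

variable {b e e' : ℝ} {f g : ℝ⟦X⟧}

theorem multichoose_eq_prod_div_factorial (r : ℝ) (n : ℕ) :
    Ring.multichoose r n = (∏ j ∈ Finset.range n, (r + j)) / n.factorial := by
  rw [eq_div_iff (by positivity), mul_comm, ← nsmul_eq_mul,
    Ring.factorial_nsmul_multichoose_eq_ascPochhammer, Polynomial.ascPochhammer_smeval_eq_eval]
  induction n with
  | zero => simp
  | succ n ih => rw [ascPochhammer_succ_eval, ih, Finset.prod_range_succ]

/-- At the poles of the Gamma function this says that the limit is `0`. -/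
theorem tendsto_multichoose_mul_rpow (r : ℝ) :
    Tendsto (fun n : ℕ => Ring.multichoose r n * (n : ℝ) ^ (1 - r)) atTop
      (𝓝 (Real.Gamma r)⁻¹) := by
  by_cases hr : ∃ m : ℕ, r = -m
  · obtain ⟨m, rfl⟩ := hr
    rw [Real.Gamma_neg_nat_eq_zero, inv_zero]
    refine tendsto_const_nhds.congr' ?_
    filter_upwards [eventually_gt_atTop m] with n hn
    rw [multichoose_eq_prod_div_factorial,
      Finset.prod_eq_zero (Finset.mem_range.2 hn) (neg_add_cancel _), zero_div, zero_mul]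
  · push Not at hr
    have hlim := ((Real.GammaSeq_tendsto_Gamma r).inv₀ (Real.Gamma_ne_zero hr)).mul
      (tendsto_natCast_div_add_atTop r)
    rw [mul_one] at hlim
    refine hlim.congr' ?_
    filter_upwards [eventually_gt_atTop 0] with n hn
    have hn' : (0 : ℝ) < n := Nat.cast_pos.2 hn
    have hnr : (n : ℝ) + r ≠ 0 := fun h => hr n (by linarith)
    have hpow := (Real.rpow_pos_of_pos hn' r).ne'
    have hfactorial : (n.factorial : ℝ) ≠ 0 := by positivity
    rw [multichoose_eq_prod_div_factorial, Real.GammaSeq, Finset.prod_range_succ,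
      Real.rpow_sub hn', Real.rpow_one, inv_div, add_comm r]
    field_simp

theorem tendsto_coeff_pow_mul_negBinomialSeries (hb : b ≠ 0) (c : ℕ) (r : ℝ) :
    Tendsto (fun n : ℕ =>
      coeff n ((1 - negBinomialSeries b (-1 / 2)) ^ c * negBinomialSeries b r) / b ^ n *
        (n : ℝ) ^ (1 - r)) atTop (𝓝 (Real.Gamma r)⁻¹) := by
  induction c generalizing r with
  | zero =>
    refine (tendsto_multichoose_mul_rpow r).congr fun n => ?_
    rw [pow_zero, one_mul, coeff_negBinomialSeries, mul_div_cancel_left₀ _ (pow_ne_zero n hb)]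
  | succ c ih =>
    have hdecay : Tendsto (fun n : ℕ => (n : ℝ) ^ (-(1 / 2) : ℝ)) atTop (𝓝 0) :=
      (tendsto_rpow_neg_atTop (by norm_num)).comp tendsto_natCast_atTop_atTop
    have hlim := (ih r).sub ((ih (r - 1 / 2)).mul hdecay)
    rw [mul_zero, sub_zero] at hlim
    refine hlim.congr' ?_
    filter_upwards [eventually_gt_atTop 0] with n hn
    have hexpand : (1 - negBinomialSeries b (-1 / 2)) ^ (c + 1) * negBinomialSeries b r =
        (1 - negBinomialSeries b (-1 / 2)) ^ c * negBinomialSeries b r -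
          (1 - negBinomialSeries b (-1 / 2)) ^ c * negBinomialSeries b (r - 1 / 2) := by
      rw [show r - 1 / 2 = -1 / 2 + r by ring, negBinomialSeries_add]
      ring
    rw [hexpand, map_sub, mul_assoc _ ((n : ℝ) ^ _), ← Real.rpow_add (Nat.cast_pos.2 hn)]
    ring_nf

/-- `f` is a positive multiple of `(1 - bX) ^ (-e)` up to a power of `1 - √(1 - bX)`. The latter
is `1` at the singularity `X = 1 / b`, so it does not affect the leading asymptotics of the
coefficients of `f`. -/
def HasSingularExponent (b : ℝ) (f : ℝ⟦X⟧) (e : ℝ) : Prop :=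
  ∃ a > 0, ∃ c : ℕ,
    f = C a * ((1 - negBinomialSeries b (-1 / 2)) ^ c * negBinomialSeries b e)

theorem hasSingularExponent_one (b : ℝ) : HasSingularExponent b 1 0 :=
  ⟨1, one_pos, 0, by simp [negBinomialSeries_zero]⟩

theorem hasSingularExponent_one_sub_sqrt (b : ℝ) :
    HasSingularExponent b (1 - negBinomialSeries b (-1 / 2)) 0 :=
  ⟨1, one_pos, 1, by simp [negBinomialSeries_zero]⟩

theorem hasSingularExponent_negBinomialSeries (b e : ℝ) :
    HasSingularExponent b (negBinomialSeries b e) e :=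
  ⟨1, one_pos, 0, by simp⟩

theorem hasSingularExponent_C (b : ℝ) {a : ℝ} (ha : 0 < a) : HasSingularExponent b (C a) 0 :=
  ⟨a, ha, 0, by simp [negBinomialSeries_zero]⟩

theorem HasSingularExponent.mul (hf : HasSingularExponent b f e)
    (hg : HasSingularExponent b g e') : HasSingularExponent b (f * g) (e + e') := by
  obtain ⟨a, ha, c, rfl⟩ := hf
  obtain ⟨a', ha', c', rfl⟩ := hg
  exact ⟨a * a', mul_pos ha ha', c + c', by rw [negBinomialSeries_add, map_mul]; ring⟩

theorem HasSingularExponent.list_prod {α : Type*} {F : List α} {u : α → ℝ⟦X⟧} {e : α → ℝ}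
    (h : ∀ t ∈ F, HasSingularExponent b (u t) (e t)) :
    HasSingularExponent b (F.map u).prod (F.map e).sum := by
  induction F with
  | nil => exact hasSingularExponent_one b
  | cons t F ih =>
    rw [List.forall_mem_cons] at h
    exact h.1.mul (ih h.2)

theorem HasSingularExponent.tendsto_coeff_sqrt_mul_div_coeff (hb : b ≠ 0) (he : 0 < e)
    (hf : HasSingularExponent b f e) :
    Tendsto (fun n : ℕ => coeff n (negBinomialSeries b (-1 / 2) * f) / coeff n f * √n) atTop
      (𝓝 (Real.Gamma e / Real.Gamma (e - 1 / 2))) := by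
  obtain ⟨a, ha, c, rfl⟩ := hf
  have hlim := (tendsto_coeff_pow_mul_negBinomialSeries hb c (e - 1 / 2)).div
    (tendsto_coeff_pow_mul_negBinomialSeries hb c e) (inv_ne_zero (Real.Gamma_pos_of_pos he).ne')
  rw [inv_div_inv] at hlim
  refine hlim.congr' ?_
  filter_upwards [eventually_gt_atTop 0] with n hn
  have hsqrt : negBinomialSeries b (-1 / 2) *
      (C a * ((1 - negBinomialSeries b (-1 / 2)) ^ c * negBinomialSeries b e)) =
      C a * ((1 - negBinomialSeries b (-1 / 2)) ^ c * negBinomialSeries b (e - 1 / 2)) := by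
    rw [show e - 1 / 2 = -1 / 2 + e by ring, negBinomialSeries_add]
    ring
  rw [hsqrt, coeff_C_mul, coeff_C_mul, mul_div_mul_left _ _ ha.ne', Pi.div_apply,
    mul_div_mul_comm, div_div_div_cancel_right₀ (pow_ne_zero n hb),
    ← Real.rpow_sub (Nat.cast_pos.2 hn), Real.sqrt_eq_rpow]
  ring_nf

end SingularExponent

section OddIntegers

theorem tendsto_sqrt_two_mul_add_one_div :
    Tendsto (fun n : ℕ => √((2 * n + 1 : ℕ) : ℝ) / (√2 * √((n : ℝ) + 1))) atTop (𝓝 1) := by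
  have h : Tendsto (fun n : ℕ => 1 - 1 / 2 * (1 / ((n : ℝ) + 1))) atTop (𝓝 1) := by
    simpa only [mul_zero, sub_zero] using
      ((tendsto_one_div_add_atTop_nhds_zero_nat (𝕜 := ℝ)).const_mul (1 / 2)).const_sub 1
  have hsqrt := (Real.continuous_sqrt.tendsto 1).comp h
  rw [Real.sqrt_one] at hsqrt
  refine hsqrt.congr fun n => ?_
  rw [← Real.sqrt_mul (by norm_num), ← Real.sqrt_div (by positivity), Function.comp_apply]
  congr 1
  push_cast
  field_simp
  ring

theorem atTop_inf_odd_le_map_two_mul_add_one :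
    atTop ⊓ 𝓟 {n : ℕ | Odd n} ≤ map (fun n : ℕ => 2 * n + 1) atTop := by
  intro s hs
  obtain ⟨N, hN⟩ := mem_atTop_sets.1 (mem_map.1 hs)
  rw [mem_inf_principal]
  filter_upwards [eventually_ge_atTop (2 * N + 1)] with n hn
  rintro ⟨k, rfl⟩
  exact hN k (by lia)

theorem isEquivalent_const_mul_sqrt_two_div_sqrt {f : ℕ → ℝ} {c : ℝ} (hc : c ≠ 0)
    (h : Tendsto (fun n : ℕ => f (2 * n + 1) * √(n + 1)) atTop (𝓝 c)) :
    f ~[atTop ⊓ 𝓟 {n : ℕ | Odd n}] fun n : ℕ => c * (√2 / √(n : ℝ)) := by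
  refine isEquivalent_of_tendsto_one (Tendsto.mono_left ?_ atTop_inf_odd_le_map_two_mul_add_one)
  have hlim := (h.div_const c).mul tendsto_sqrt_two_mul_add_one_div
  rw [div_self hc, mul_one] at hlim
  refine tendsto_map'_iff.2 (hlim.congr fun n => ?_)
  have hn : √((n : ℝ) + 1) ≠ 0 := by positivity
  have hodd : √((2 * n + 1 : ℕ) : ℝ) ≠ 0 := by positivity
  rw [Function.comp_apply, Pi.div_apply]
  field_simp

theorem isTheta_const_mul_const_div {α : Type*} {l : Filter α} (g : α → ℝ) {a b : ℝ}
    (ha : a ≠ 0) (hb : b ≠ 0) : (fun x => a * (b / g x)) =Θ[l] fun x => 1 / g x := by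
  have h := (isTheta_refl (fun x => 1 / g x) l).const_mul_left (mul_ne_zero ha hb)
  simpa only [mul_one_div, mul_div_assoc] using h

end OddIntegers

namespace PlaneTree

section Addresses

variable {p q p' q' : List ℕ}

theorem not_leftOf_nil_left : ¬ LeftOf [] q := by
  simp [LeftOf]

theorem not_leftOf_nil_right : ¬ LeftOf p [] := by
  simp [LeftOf]

theorem leftOf_cons_cons {i j : ℕ} :
    LeftOf (i :: p) (j :: q) ↔ i < j ∨ (i = j ∧ LeftOf p q) := by
  constructor
  · rintro ⟨_ | ⟨c, r⟩, a, b, hab, hp, hq⟩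
    · simp only [List.nil_append, List.cons_prefix_cons] at hp hq
      exact Or.inl (by lia)
    · simp only [List.cons_append, List.cons_prefix_cons] at hp hq
      exact Or.inr ⟨hp.1.symm.trans hq.1, r, a, b, hab, hp.2, hq.2⟩
  · rintro (h | ⟨rfl, r, a, b, hab, hp, hq⟩)
    · exact ⟨[], i, j, h, by simp, by simp⟩
    · exact ⟨i :: r, a, b, hab, by simpa using hp, by simpa using hq⟩

theorem leftOf_append_singleton_iff {i j : ℕ} : LeftOf (q ++ [i]) (q ++ [j]) ↔ i < j := by
  induction q with
  | nil => simp [leftOf_cons_cons, not_leftOf_nil_left]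
  | cons a q ih => simp [leftOf_cons_cons, ih]

theorem LeftOf.of_prefix (h : LeftOf p q) (hp : p <+: p') (hq : q <+: q') : LeftOf p' q' := by
  obtain ⟨r, a, b, hab, ha, hb⟩ := h
  exact ⟨r, a, b, hab, ha.trans hp, hb.trans hq⟩

theorem LeftOf.lt (h : LeftOf p q) : p < q := by
  induction p generalizing q with
  | nil => exact absurd h not_leftOf_nil_left
  | cons i p ih =>
    cases q with
    | nil => exact absurd h not_leftOf_nil_right
    | cons j q =>
      exact List.cons_lt_cons_iff.2 ((leftOf_cons_cons.1 h).imp_right (And.imp_right ih))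

theorem LeftOf.asymm (h : LeftOf p q) : ¬ LeftOf q p :=
  fun h' => lt_asymm h.lt h'.lt

theorem LeftOf.not_prefix (h : LeftOf p q) : ¬ p <+: q :=
  fun h' => (h.of_prefix h' List.prefix_rfl).lt.false

theorem LeftOf.not_prefix_symm (h : LeftOf p q) : ¬ q <+: p :=
  fun h' => (h.of_prefix List.prefix_rfl h').lt.false

theorem prefix_or_leftOf_of_lt (h : p < q) : p <+: q ∨ LeftOf p q := by
  induction p generalizing q with
  | nil => exact Or.inl List.nil_prefix
  | cons i p ih =>
    cases q with
    | nil => exact absurd h (List.not_lt_nil _)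
    | cons j q =>
      rcases List.cons_lt_cons_iff.1 h with hij | ⟨rfl, hpq⟩
      · exact Or.inr (leftOf_cons_cons.2 (Or.inl hij))
      · simpa [leftOf_cons_cons] using ih hpq

end Addresses

section SameShape

variable {A B C A' B' : Set (List ℕ)} {f : List ℕ → List ℕ}

/-- On `A`, the map `f` preserves and reflects both the ancestor order and the left-to-right
order of addresses. -/
def PreservesShapeOn (f : List ℕ → List ℕ) (A : Set (List ℕ)) : Prop :=
  ∀ p ∈ A, ∀ q ∈ A, (p <+: q ↔ f p <+: f q) ∧ (LeftOf p q ↔ LeftOf (f p) (f q))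

/-- Two sets of addresses are isomorphic with respect to the ancestor order and the left-to-right
order. -/
def SameShape (A B : Set (List ℕ)) : Prop :=
  ∃ f : List ℕ → List ℕ, PreservesShapeOn f A ∧ f '' A = B

/-- Any two addresses are comparable for one of the two orders, so reflection is automatic for the
second one. -/
theorem preservesShapeOn_of_leftOf_imp (hpre : ∀ p ∈ A, ∀ q ∈ A, p <+: q ↔ f p <+: f q)
    (hleft : ∀ p ∈ A, ∀ q ∈ A, LeftOf p q → LeftOf (f p) (f q)) : PreservesShapeOn f A := by
  refine fun p hp q hq => ⟨hpre p hp q hq, hleft p hp q hq, fun h => ?_⟩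
  rcases lt_trichotomy p q with hpq | rfl | hqp
  · exact (prefix_or_leftOf_of_lt hpq).resolve_left
      fun h' => h.not_prefix ((hpre p hp q hq).1 h')
  · exact absurd h.lt (lt_irrefl _)
  · rcases prefix_or_leftOf_of_lt hqp with h' | h'
    · exact absurd ((hpre q hq p hp).1 h') h.not_prefix_symm
    · exact absurd (hleft q hq p hp h') h.asymm

theorem PreservesShapeOn.mono (h : PreservesShapeOn f B) (hAB : A ⊆ B) : PreservesShapeOn f A :=
  fun p hp q hq => h p (hAB hp) q (hAB hq)

theorem PreservesShapeOn.injOn (h : PreservesShapeOn f A) : Set.InjOn f A := fun p hp q hq hpq =>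
  antisymm (r := (· <+: ·)) ((h p hp q hq).1.2 (hpq ▸ List.prefix_rfl))
    ((h q hq p hp).1.2 (hpq ▸ List.prefix_rfl))

theorem PreservesShapeOn.exists_inverse (h : PreservesShapeOn f A) :
    ∃ g, PreservesShapeOn g (f '' A) ∧ ∀ p ∈ A, g (f p) = p := by
  have hinv : ∀ p ∈ A, Function.invFunOn f A (f p) = p := fun p hp =>
    h.injOn.leftInvOn_invFunOn hp
  refine ⟨Function.invFunOn f A, ?_, hinv⟩
  rintro _ ⟨p, hp, rfl⟩ _ ⟨q, hq, rfl⟩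
  rw [hinv p hp, hinv q hq]
  exact ⟨(h p hp q hq).1.symm, (h p hp q hq).2.symm⟩

theorem PreservesShapeOn.sameShape_image (h : PreservesShapeOn f A) : SameShape A (f '' A) :=
  ⟨f, h, rfl⟩

theorem SameShape.symm (h : SameShape A B) : SameShape B A := by
  obtain ⟨f, hf, rfl⟩ := h
  obtain ⟨g, hg, hgf⟩ := hf.exists_inverse
  exact ⟨g, hg, by rw [Set.image_image, Set.image_congr hgf, Set.image_id']⟩

theorem SameShape.trans (h : SameShape A B) (h' : SameShape B C) : SameShape A C := by
  obtain ⟨f, hf, rfl⟩ := h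
  obtain ⟨g, hg, rfl⟩ := h'
  refine ⟨g ∘ f, fun p hp q hq => ?_, Set.image_comp g f A⟩
  have hfpq := hf p hp q hq
  have hgpq := hg _ (Set.mem_image_of_mem f hp) _ (Set.mem_image_of_mem f hq)
  exact ⟨hfpq.1.trans hgpq.1, hfpq.2.trans hgpq.2⟩

theorem sameShape_empty : SameShape ∅ ∅ :=
  ⟨id, by simp [PreservesShapeOn], Set.image_empty id⟩

theorem preservesShapeOn_cons (i : ℕ) (A : Set (List ℕ)) : PreservesShapeOn (List.cons i) A :=
  fun p _ q _ => by simp [leftOf_cons_cons]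

theorem SameShape.union (hA : SameShape A A') (hB : SameShape B B')
    (hAB : ∀ p ∈ A, ∀ q ∈ B, LeftOf p q) (hAB' : ∀ p ∈ A', ∀ q ∈ B', LeftOf p q) :
    SameShape (A ∪ B) (A' ∪ B') := by
  classical
  obtain ⟨f, hf, rfl⟩ := hA
  obtain ⟨g, hg, rfl⟩ := hB
  have hfA : ∀ p ∈ A, A.piecewise f g p = f p := fun p hp => A.piecewise_eq_of_mem f g hp
  have hgB : ∀ q ∈ B, A.piecewise f g q = g q := fun q hq =>
    A.piecewise_eq_of_notMem f g fun hqA => (hAB q hqA q hq).lt.false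
  have hfg : ∀ p ∈ A, ∀ q ∈ B, LeftOf (f p) (g q) := fun p hp q hq =>
    hAB' _ (Set.mem_image_of_mem f hp) _ (Set.mem_image_of_mem g hq)
  refine ⟨A.piecewise f g, ?_, by rw [Set.image_union, Set.image_congr hfA, Set.image_congr hgB]⟩
  rintro p (hp | hp) q (hq | hq)
  · simpa only [hfA p hp, hfA q hq] using hf p hp q hq
  · have h := hAB p hp q hq
    have h' := hfg p hp q hq
    simp only [hfA p hp, hgB q hq, h, h', h.not_prefix, h'.not_prefix, and_self]
  · have h := hAB q hq p hp
    have h' := hfg q hq p hp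
    simp only [hgB p hp, hfA q hq, h.asymm, h'.asymm, h.not_prefix_symm, h'.not_prefix_symm,
      and_self]
  · simpa only [hgB p hp, hgB q hq] using hg p hp q hq

theorem SameShape.insert_root {r r' : List ℕ} (h : SameShape A A')
    (hr : ∀ p ∈ A, r <+: p ∧ p ≠ r) (hr' : ∀ p ∈ A', r' <+: p ∧ p ≠ r') :
    SameShape (insert r A) (insert r' A') := by
  classical
  obtain ⟨f, hf, rfl⟩ := h
  have hfA : ∀ p ∈ A, Function.update f r r' p = f p := fun p hp =>
    Function.update_of_ne (hr p hp).2 r' f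
  refine ⟨Function.update f r r', preservesShapeOn_of_leftOf_imp ?_ ?_, by
    rw [Set.image_insert_eq, Function.update_self, Set.image_congr hfA]⟩
  · rintro p (rfl | hp) q (rfl | hq)
    · simp only [List.prefix_rfl]
    · obtain ⟨h, -⟩ := hr q hq
      obtain ⟨h', -⟩ := hr' _ (Set.mem_image_of_mem f hq)
      simp only [Function.update_self, hfA q hq, h, h']
    · obtain ⟨h, hne⟩ := hr p hp
      obtain ⟨h', hne'⟩ := hr' _ (Set.mem_image_of_mem f hp)
      rw [Function.update_self, hfA p hp]
      exact iff_of_false (fun hpq => hne (antisymm (r := (· <+: ·)) hpq h))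
        (fun hpq => hne' (antisymm (r := (· <+: ·)) hpq h'))
    · simpa only [hfA p hp, hfA q hq] using (hf p hp q hq).1
  · rintro p (rfl | hp) q (rfl | hq) hpq
    · exact absurd hpq.lt (lt_irrefl _)
    · exact absurd (hr q hq).1 hpq.not_prefix
    · exact absurd (hr p hp).1 hpq.not_prefix_symm
    · simpa only [hfA p hp, hfA q hq] using (hf p hp q hq).2.1 hpq

end SameShape

section Vertices

variable {T : PlaneTree} {p q : List ℕ} {i j : ℕ}

theorem induction_on_children {P : PlaneTree → Prop}
    (node : ∀ ts : List PlaneTree, (∀ t ∈ ts, P t) → P (node ts)) : ∀ T, P T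
  | .node ts => node ts fun t _ => induction_on_children node t

theorem nil_mem_vertices (T : PlaneTree) : [] ∈ T.vertices := by
  simp [vertices, IsVertex]

theorem cons_mem_vertices_node {ts : List PlaneTree} :
    i :: p ∈ (node ts).vertices ↔ ∃ h : i < ts.length, p ∈ ts[i].vertices := by
  simp [vertices, IsVertex]

theorem mem_vertices_of_prefix (hq : q ∈ T.vertices) (h : p <+: q) : p ∈ T.vertices := by
  induction p generalizing T q with
  | nil => exact nil_mem_vertices T
  | cons i p ih =>
    obtain ⟨ts⟩ := T
    obtain ⟨r, rfl⟩ := h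
    obtain ⟨hi, hq⟩ := cons_mem_vertices_node.1 hq
    exact cons_mem_vertices_node.2 ⟨hi, ih hq (List.prefix_append p r)⟩

theorem append_singleton_mem_vertices_of_le (h : q ++ [i] ∈ T.vertices) (hji : j ≤ i) :
    q ++ [j] ∈ T.vertices := by
  induction q generalizing T with
  | nil =>
    obtain ⟨ts⟩ := T
    obtain ⟨hi, -⟩ := cons_mem_vertices_node.1 h
    exact cons_mem_vertices_node.2 ⟨hji.trans_lt hi, nil_mem_vertices _⟩
  | cons a q ih =>
    obtain ⟨ts⟩ := T
    obtain ⟨ha, h⟩ := cons_mem_vertices_node.1 h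
    exact cons_mem_vertices_node.2 ⟨ha, ih h⟩

theorem vertices_injective : Function.Injective vertices := by
  intro S
  induction S using induction_on_children with
  | node as ih =>
    rintro ⟨bs⟩ h
    have hmem : ∀ i p, (∃ hi : i < as.length, p ∈ as[i].vertices) ↔
        ∃ hi : i < bs.length, p ∈ bs[i].vertices := fun i p => by
      rw [← cons_mem_vertices_node, ← cons_mem_vertices_node, h]
    have hlength : as.length = bs.length := eq_of_forall_lt_iff fun i => by
      simpa [nil_mem_vertices] using hmem i []
    congr 1
    refine List.ext_getElem hlength fun i ha hb => ih _ (List.getElem_mem ha) ?_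
    ext p
    simpa [ha, hb] using hmem i p

end Vertices

section Rigidity

variable {S T : PlaneTree} {f : List ℕ → List ℕ} {p q : List ℕ} {i j : ℕ}

theorem PreservesShapeOn.length_le (hf : PreservesShapeOn f S.vertices) (hp : p ∈ S.vertices) :
    p.length ≤ (f p).length := by
  induction p using List.reverseRecOn with
  | nil => exact Nat.zero_le _
  | append_singleton q i ih =>
    have hqp : q <+: q ++ [i] := List.prefix_append q [i]
    have hq := mem_vertices_of_prefix hp hqp
    have hfqp : f q <+: f (q ++ [i]) := (hf q hq _ hp).1.1 hqp
    have hne : f q ≠ f (q ++ [i]) := fun h => by simpa using hf.injOn hq hp h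
    have hlt : (f q).length < (f (q ++ [i])).length :=
      hfqp.length_le.lt_of_ne fun h => hne (hfqp.eq_of_length h)
    rw [List.length_append, List.length_singleton]
    exact Nat.succ_le_of_lt ((ih hq).trans_lt hlt)

theorem PreservesShapeOn.exists_apply_append_singleton (hf : PreservesShapeOn f S.vertices)
    (hlength : ∀ p ∈ S.vertices, (f p).length = p.length) (hq : f q = q)
    (h : q ++ [i] ∈ S.vertices) : ∃ j, f (q ++ [i]) = q ++ [j] := by
  have hqi : q <+: q ++ [i] := List.prefix_append q [i]
  have hfqi := (hf q (mem_vertices_of_prefix h hqi) _ h).1.1 hqi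
  rw [hq] at hfqi
  obtain ⟨r, hr⟩ := hfqi
  have hlen := hlength _ h
  rw [← hr, List.length_append, List.length_append, Nat.add_left_cancel_iff] at hlen
  obtain ⟨j, rfl⟩ := List.length_eq_one_iff.1 hlen
  exact ⟨j, hr.symm⟩

theorem PreservesShapeOn.le_of_apply_append_singleton (hf : PreservesShapeOn f S.vertices)
    (hlength : ∀ p ∈ S.vertices, (f p).length = p.length) (hq : f q = q)
    (h : q ++ [i] ∈ S.vertices) (hij : f (q ++ [i]) = q ++ [j]) : i ≤ j := by
  induction i generalizing j with
  | zero => exact Nat.zero_le j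
  | succ i ih =>
    have hi := append_singleton_mem_vertices_of_le h i.le_succ
    obtain ⟨j', hj'⟩ := hf.exists_apply_append_singleton hlength hq hi
    have hlt : j' < j := by
      rw [← leftOf_append_singleton_iff (q := q), ← hj', ← hij, ← (hf _ hi _ h).2,
        leftOf_append_singleton_iff]
      exact i.lt_succ_self
    exact (ih hi hj').trans_lt hlt

/-- Both the length of an address and its last entry can only grow under a shape-preserving map,
and the same is true of the inverse map. -/
theorem PreservesShapeOn.apply_eq_self (hf : PreservesShapeOn f S.vertices)
    (hfT : f '' S.vertices = T.vertices) (hp : p ∈ S.vertices) : f p = p := by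
  obtain ⟨g, hg, hgf⟩ := hf.exists_inverse
  rw [hfT] at hg
  have hmem : ∀ p ∈ S.vertices, f p ∈ T.vertices := fun p hp => hfT ▸ Set.mem_image_of_mem f hp
  have hlength : ∀ p ∈ S.vertices, (f p).length = p.length := fun p hp =>
    le_antisymm ((hg.length_le (hmem p hp)).trans_eq (congrArg _ (hgf p hp))) (hf.length_le hp)
  have hlength' : ∀ p ∈ T.vertices, (g p).length = p.length := by
    rw [← hfT]
    rintro _ ⟨p, hp, rfl⟩
    rw [hgf p hp, hlength p hp]
  induction p using List.reverseRecOn with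
  | nil => simpa using hlength [] hp
  | append_singleton q i ih =>
    have hqS := mem_vertices_of_prefix hp (List.prefix_append q [i])
    have hfq : f q = q := ih hqS
    have hgq : g q = q := by simpa only [hfq] using hgf q hqS
    obtain ⟨j, hj⟩ := hf.exists_apply_append_singleton hlength hfq hp
    have hgj : g (q ++ [j]) = q ++ [i] := by rw [← hj, hgf _ hp]
    have hij := hf.le_of_apply_append_singleton hlength hfq hp hj
    have hji := hg.le_of_apply_append_singleton hlength' hgq (hj ▸ hmem _ hp) hgj
    rw [hj, le_antisymm hij hji]

theorem SameShape.eq_of_vertices (h : SameShape S.vertices T.vertices) : S = T := by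
  obtain ⟨f, hf, hfT⟩ := h
  refine vertices_injective ?_
  rw [← hfT, Set.image_congr fun p hp => hf.apply_eq_self hfT hp, Set.image_id']

end Rigidity

section Shape

variable {S T : PlaneTree} {as bs ts F : List PlaneTree} {A B U : Set (List ℕ)} {p q r : List ℕ}
  {f : List ℕ → List ℕ} {i : ℕ}

/-- The vertices of the trees of the forest `ts`, addressed as the vertices of `node ts` other than
its root. -/
def forestVertices (ts : List PlaneTree) : Set (List ℕ) :=
  (node ts).vertices \ {[]}

theorem nil_notMem_forestVertices : [] ∉ forestVertices ts := fun h => h.2 rfl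

theorem nil_prefix_and_ne_of_mem_forestVertices (ts : List PlaneTree) :
    ∀ p ∈ forestVertices ts, [] <+: p ∧ p ≠ [] := fun _ hp =>
  ⟨List.nil_prefix, ne_of_mem_of_not_mem hp nil_notMem_forestVertices⟩

theorem cons_mem_forestVertices :
    i :: p ∈ forestVertices ts ↔ ∃ h : i < ts.length, p ∈ ts[i].vertices := by
  simp [forestVertices, cons_mem_vertices_node]

theorem insert_nil_forestVertices (ts : List PlaneTree) :
    insert [] (forestVertices ts) = (node ts).vertices := by
  rw [forestVertices, Set.insert_sdiff_singleton, Set.insert_eq_of_mem (nil_mem_vertices _)]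

theorem finite_forestVertices (ts : List PlaneTree) : (forestVertices ts).Finite :=
  (vertices_finite _).sdiff

theorem forestVertices_nil : forestVertices [] = ∅ := by
  ext (_ | ⟨i, p⟩)
  · simp [nil_notMem_forestVertices]
  · simp [cons_mem_forestVertices]

theorem forestVertices_singleton (T : PlaneTree) :
    forestVertices [T] = List.cons 0 '' T.vertices := by
  ext (_ | ⟨i, p⟩)
  · simp [nil_notMem_forestVertices]
  · cases i <;> simp [cons_mem_forestVertices]

theorem sameShape_forestVertices_singleton (T : PlaneTree) :
    SameShape (forestVertices [T]) T.vertices :=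
  forestVertices_singleton T ▸ (preservesShapeOn_cons 0 _).sameShape_image.symm

/-- Renumbers the children of the root from `k` on, to make room for `k` further subtrees on the
left. -/
def shiftRoot (k : ℕ) : List ℕ → List ℕ
  | [] => []
  | i :: p => (k + i) :: p

theorem preservesShapeOn_shiftRoot (k : ℕ) (A : Set (List ℕ)) :
    PreservesShapeOn (shiftRoot k) A := by
  rintro (_ | ⟨i, p⟩) - (_ | ⟨j, q⟩) - <;>
    simp [shiftRoot, leftOf_cons_cons, not_leftOf_nil_left, not_leftOf_nil_right]

theorem forestVertices_append (as bs : List PlaneTree) :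
    forestVertices (as ++ bs) = forestVertices as ∪ shiftRoot as.length '' forestVertices bs := by
  ext (_ | ⟨i, p⟩)
  · simp only [nil_notMem_forestVertices, Set.mem_union, Set.mem_image, false_or, false_iff]
    rintro ⟨_ | ⟨j, q⟩, hq, h⟩
    · exact nil_notMem_forestVertices hq
    · exact absurd h (List.cons_ne_nil _ _)
  · rw [Set.mem_union, cons_mem_forestVertices, cons_mem_forestVertices]
    constructor
    · rintro ⟨hi, hp⟩
      rcases lt_or_ge i as.length with hlt | hge
      · exact Or.inl ⟨hlt, by rwa [List.getElem_append_left hlt] at hp⟩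
      · rw [List.getElem_append_right hge] at hp
        refine Or.inr ⟨(i - as.length) :: p, cons_mem_forestVertices.2 ⟨_, hp⟩, ?_⟩
        rw [shiftRoot, Nat.add_sub_cancel' hge]
    · rintro (⟨hi, hp⟩ | ⟨_ | ⟨j, q⟩, hq, h⟩)
      · exact ⟨by grind, by rwa [List.getElem_append_left hi]⟩
      · exact absurd hq nil_notMem_forestVertices
      · obtain ⟨rfl, rfl⟩ := List.cons.inj h
        obtain ⟨hj, hq⟩ := cons_mem_forestVertices.1 hq
        exact ⟨by grind, by simpa [List.getElem_append_right] using hq⟩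

theorem leftOf_of_mem_forestVertices (hp : p ∈ forestVertices as)
    (hq : q ∈ shiftRoot as.length '' forestVertices bs) : LeftOf p q := by
  obtain ⟨_ | ⟨j, q⟩, hq, rfl⟩ := hq
  · exact absurd hq nil_notMem_forestVertices
  cases p with
  | nil => exact absurd hp nil_notMem_forestVertices
  | cons i p =>
    obtain ⟨hi, -⟩ := cons_mem_forestVertices.1 hp
    exact leftOf_cons_cons.2 (Or.inl (Nat.lt_add_right j hi))

theorem SameShape.forestVertices_append (hA : SameShape (forestVertices as) A)
    (hB : SameShape (forestVertices bs) B) (hAB : ∀ p ∈ A, ∀ q ∈ B, LeftOf p q) :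
    SameShape (forestVertices (as ++ bs)) (A ∪ B) := by
  rw [PlaneTree.forestVertices_append]
  have hbs := (preservesShapeOn_shiftRoot as.length (forestVertices bs)).sameShape_image.symm
  exact hA.union (hbs.trans hB) (fun p hp q hq => leftOf_of_mem_forestVertices hp hq) hAB

theorem SameShape.forestVertices_insert (h : SameShape (forestVertices F) U)
    (hr : ∀ p ∈ U, r <+: p ∧ p ≠ r) : SameShape (forestVertices [node F]) (insert r U) := by
  refine (sameShape_forestVertices_singleton (node F)).trans ?_
  rw [← insert_nil_forestVertices]
  exact h.insert_root (nil_prefix_and_ne_of_mem_forestVertices F) hr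

/-- Split off the leftmost tree: its root is the lexicographically least address. -/
theorem exists_sameShape_forestVertices (s : Finset (List ℕ)) :
    ∃ F, SameShape (forestVertices F) s := by
  classical
  induction s using Finset.strongInduction with
  | H s ih =>
  rcases s.eq_empty_or_nonempty with rfl | hs
  · exact ⟨[], by simpa [forestVertices_nil] using sameShape_empty⟩
  obtain ⟨r, hr, hmin⟩ : ∃ r ∈ s, ∀ p ∈ s, r ≤ p := ⟨s.min' hs, s.min'_mem hs, s.min'_le⟩
  obtain ⟨F, hF⟩ := ih {p ∈ s | r <+: p ∧ p ≠ r}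
    (Finset.filter_ssubset.2 ⟨r, hr, fun h => h.2 rfl⟩)
  obtain ⟨G, hG⟩ := ih {p ∈ s | LeftOf r p}
    (Finset.filter_ssubset.2 ⟨r, hr, fun h => h.lt.false⟩)
  refine ⟨[node F] ++ G, ?_⟩
  have hleft : ∀ p ∈ (insert r ↑{p ∈ s | r <+: p ∧ p ≠ r} : Set (List ℕ)),
      ∀ q ∈ (↑{p ∈ s | LeftOf r p} : Set (List ℕ)), LeftOf p q := by
    rintro p (rfl | hp) q hq
    · exact (Finset.mem_filter.1 hq).2
    · exact (Finset.mem_filter.1 hq).2.of_prefix (Finset.mem_filter.1 hp).2.1 List.prefix_rfl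
  convert (hF.forestVertices_insert fun p hp => (Finset.mem_filter.1 hp).2).forestVertices_append
    hG hleft
  ext p
  simp only [Finset.mem_coe, Set.mem_union, Set.mem_insert_iff, Finset.mem_filter]
  refine ⟨fun hp => ?_, ?_⟩
  · rcases (hmin p hp).eq_or_lt with rfl | hlt
    · exact Or.inl (Or.inl rfl)
    · exact (prefix_or_leftOf_of_lt hlt).imp (fun h => Or.inr ⟨hp, h, hlt.ne'⟩) fun h => ⟨hp, h⟩
  · rintro ((rfl | ⟨hp, -⟩) | ⟨hp, -⟩) <;> assumption

/-- The forest whose vertices, with both orders, are isomorphic to the given set of addresses;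
meaningful for finite sets only. -/
noncomputable def shape (U : Set (List ℕ)) : List PlaneTree :=
  Classical.epsilon fun F => SameShape (forestVertices F) U

theorem sameShape_shape (hU : U.Finite) : SameShape (forestVertices (shape U)) U :=
  Classical.epsilon_spec (hU.coe_toFinset ▸ exists_sameShape_forestVertices hU.toFinset)

theorem SameShape.shape_eq_shape (h : SameShape A B) : shape A = shape B := by
  unfold shape
  congr 1
  ext F
  exact ⟨fun hA => hA.trans h, fun hB => hB.trans h.symm⟩

theorem SameShape.shape_eq (h : SameShape (forestVertices F) U) : shape U = F := by
  have hshape : SameShape (forestVertices (shape U)) U :=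
    Classical.epsilon_spec (p := fun F => SameShape (forestVertices F) U) ⟨F, h⟩
  have hnode := (hshape.trans h.symm).insert_root (nil_prefix_and_ne_of_mem_forestVertices _)
    (nil_prefix_and_ne_of_mem_forestVertices _)
  rw [insert_nil_forestVertices, insert_nil_forestVertices] at hnode
  exact node.inj hnode.eq_of_vertices

theorem shape_empty : shape ∅ = [] :=
  SameShape.shape_eq (forestVertices_nil ▸ sameShape_empty)

theorem shape_union (hA : A.Finite) (hB : B.Finite) (hAB : ∀ p ∈ A, ∀ q ∈ B, LeftOf p q) :
    shape (A ∪ B) = shape A ++ shape B :=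
  ((sameShape_shape hA).forestVertices_append (sameShape_shape hB) hAB).shape_eq

theorem shape_insert (hU : U.Finite) (hr : ∀ p ∈ U, r <+: p ∧ p ≠ r) :
    shape (insert r U) = [node (shape U)] :=
  ((sameShape_shape hU).forestVertices_insert hr).shape_eq

theorem preservesShapeOn_vertices_of_children
    (hpre : ∀ p ∈ S.vertices, ∀ q ∈ S.vertices, p <+: q ↔ f p <+: f q)
    (hchildren : ∀ p i j, p ++ [i] ∈ S.vertices → p ++ [j] ∈ S.vertices → i < j →
      LeftOf (f (p ++ [i])) (f (p ++ [j]))) : PreservesShapeOn f S.vertices := by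
  refine preservesShapeOn_of_leftOf_imp hpre ?_
  rintro p hp q hq ⟨r, a, b, hab, hap, hbq⟩
  have ha := mem_vertices_of_prefix hp hap
  have hb := mem_vertices_of_prefix hq hbq
  exact (hchildren r a b ha hb hab).of_prefix ((hpre _ ha p hp).1 hap) ((hpre _ hb q hq).1 hbq)

theorem isEmbedding_iff_sameShape :
    IsEmbedding S T U ↔ U ⊆ T.vertices ∧ SameShape S.vertices U := by
  classical
  refine and_congr_right fun _ => ⟨?_, ?_⟩
  · rintro ⟨f, hpre, hchildren⟩
    let g : List ℕ → List ℕ := fun p => if hp : p ∈ S.vertices then f ⟨p, hp⟩ else p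
    have hg : ∀ p (hp : p ∈ S.vertices), g p = f ⟨p, hp⟩ := fun p hp => dif_pos hp
    refine ⟨g, preservesShapeOn_vertices_of_children (fun p hp q hq => ?_)
      (fun p i j hi hj hij => ?_), ?_⟩
    · rw [hg p hp, hg q hq]
      exact hpre ⟨p, hp⟩ ⟨q, hq⟩
    · rw [hg _ hi, hg _ hj]
      exact hchildren p i j hi hj hij
    · rw [Set.image_eq_range, ← Subtype.range_coe (s := U), ← f.surjective.range_comp]
      exact congrArg Set.range (funext fun p => hg p p.2)
  · rintro ⟨f, hf, rfl⟩
    refine ⟨Equiv.Set.imageOfInjOn f S.vertices hf.injOn, fun p q => (hf p p.2 q q.2).1, ?_⟩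
    exact fun p i j hi hj hij => (hf _ hi _ hj).2.1 (leftOf_append_singleton_iff.2 hij)

theorem isEmbedding_iff_shape :
    IsEmbedding S T U ↔ U ⊆ T.vertices ∧ shape U = [S] := by
  rw [isEmbedding_iff_sameShape]
  refine and_congr_right fun hU => ?_
  have hS := sameShape_forestVertices_singleton S
  refine ⟨fun h => (hS.trans h).shape_eq, fun h => hS.symm.trans ?_⟩
  exact h ▸ sameShape_shape (T.vertices_finite.subset hU)

end Shape

section Copies

variable {F : List PlaneTree} {A B U : Set (List ℕ)} {r : List ℕ}

/-- The subsets of `A` that are isomorphic to the forest `F`. -/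
def copies (A : Set (List ℕ)) (F : List PlaneTree) : Set (Set (List ℕ)) :=
  {U | U ⊆ A ∧ shape U = F}

/-- The number of copies of the forest `F` in `A`. -/
noncomputable def copyCount (A : Set (List ℕ)) (F : List PlaneTree) : ℕ :=
  (copies A F).ncard

theorem mem_copies : U ∈ copies A F ↔ U ⊆ A ∧ shape U = F := Iff.rfl

theorem finite_copies (hA : A.Finite) (F : List PlaneTree) : (copies A F).Finite :=
  hA.finite_subsets.subset fun _ h => h.1

theorem copyCount_empty [Decidable (F = [])] : copyCount ∅ F = if F = [] then 1 else 0 := by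
  rw [copyCount]
  split_ifs with hF
  · refine Set.ncard_eq_one.2 ⟨∅, Set.ext fun U => ?_⟩
    rw [mem_copies, Set.subset_empty_iff, Set.mem_singleton_iff, and_iff_left_iff_imp]
    rintro rfl
    rw [shape_empty, hF]
  · suffices copies ∅ F = ∅ by rw [this, Set.ncard_empty]
    refine Set.eq_empty_of_forall_notMem fun U hU => hF ?_
    rw [← hU.2, Set.subset_empty_iff.1 hU.1, shape_empty]

theorem SameShape.copyCount_eq (h : SameShape A B) (F : List PlaneTree) :
    copyCount A F = copyCount B F := by
  obtain ⟨f, hf, rfl⟩ := h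
  have hshape : ∀ U ⊆ A, shape (f '' U) = shape U := fun U hU =>
    (hf.mono hU).sameShape_image.shape_eq_shape.symm
  refine Set.ncard_congr (fun U _ => f '' U)
    (fun U hU => ⟨Set.image_mono hU.1, (hshape U hU.1).trans hU.2⟩)
    (fun U V hU hV => (hf.injOn.image_eq_image_iff hU.1 hV.1).1) ?_
  rintro V ⟨hV, hVF⟩
  obtain ⟨U, hU, rfl⟩ := Set.subset_image_iff.1 hV
  exact ⟨U, ⟨hU, (hshape U hU).symm.trans hVF⟩, rfl⟩

theorem ncard_copies_insert_of_mem (hA : A.Finite) (hr : ∀ p ∈ A, r <+: p ∧ p ≠ r)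
    (F : List PlaneTree) :
    {U ∈ copies (insert r A) F | r ∈ U}.ncard = {U | U ⊆ A ∧ [node (shape U)] = F}.ncard := by
  have hrA : r ∉ A := fun h => (hr r h).2 rfl
  have hshape : ∀ U ⊆ A, shape (insert r U) = [node (shape U)] := fun U hU =>
    shape_insert (hA.subset hU) fun p hp => hr p (hU hp)
  refine (Set.ncard_congr (fun U _ => insert r U) ?_ ?_ ?_).symm
  · rintro U ⟨hU, hUF⟩
    exact ⟨⟨Set.insert_subset_insert hU, (hshape U hU).trans hUF⟩, Set.mem_insert r U⟩
  · rintro U V ⟨hU, -⟩ ⟨hV, -⟩ h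
    exact Set.powerset_insert_injOn hrA hU hV h
  · rintro V ⟨⟨hV, hVF⟩, hrV⟩
    have hdiff : V \ {r} ⊆ A := Set.sdiff_singleton_subset_iff.2 hV
    have hinsert : insert r (V \ {r}) = V := by
      rw [Set.insert_sdiff_singleton, Set.insert_eq_of_mem hrV]
    exact ⟨V \ {r}, ⟨hdiff, by rw [← hshape _ hdiff, hinsert, hVF]⟩, hinsert⟩

theorem ncard_copies_node_insert_of_mem (hA : A.Finite) (hr : ∀ p ∈ A, r <+: p ∧ p ≠ r)
    (F : List PlaneTree) :
    {U ∈ copies (insert r A) [node F] | r ∈ U}.ncard = copyCount A F := by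
  rw [ncard_copies_insert_of_mem hA hr]
  simp only [List.cons.injEq, node.injEq, and_true, copyCount, copies]

theorem copyCount_insert (hA : A.Finite) (hr : ∀ p ∈ A, r <+: p ∧ p ≠ r) (F : List PlaneTree) :
    copyCount (insert r A) F =
      copyCount A F + {U ∈ copies (insert r A) F | r ∈ U}.ncard := by
  have hrA : r ∉ A := fun h => (hr r h).2 rfl
  have hsplit : copies (insert r A) F = copies A F ∪ {U ∈ copies (insert r A) F | r ∈ U} := by
    ext U
    simp only [mem_copies, Set.mem_union, Set.mem_ofPred_eq]
    by_cases hrU : r ∈ U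
    · simpa [hrU] using fun hU _ => absurd (hU hrU) hrA
    · simp [hrU, Set.subset_insert_iff_of_notMem]
  rw [copyCount, copyCount, ← Set.ncard_union_eq ?_ (finite_copies hA F)
    ((finite_copies (hA.insert r) F).subset (Set.sep_subset _ _)), ← hsplit]
  exact Set.disjoint_left.2 fun U hU hU' => hrA (hU.1 hU'.2)

theorem copyCount_insert_node (hA : A.Finite) (hr : ∀ p ∈ A, r <+: p ∧ p ≠ r)
    (F : List PlaneTree) :
    copyCount (insert r A) [node F] = copyCount A [node F] + copyCount A F := by
  rw [copyCount_insert hA hr, ncard_copies_node_insert_of_mem hA hr]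

theorem copyCount_insert_of_length_ne_one (hA : A.Finite) (hr : ∀ p ∈ A, r <+: p ∧ p ≠ r)
    (hF : F.length ≠ 1) : copyCount (insert r A) F = copyCount A F := by
  have hempty : {U | U ⊆ A ∧ [node (shape U)] = F} = ∅ :=
    Set.eq_empty_of_forall_notMem fun U hU => hF (hU.2 ▸ List.length_singleton)
  rw [copyCount_insert hA hr, ncard_copies_insert_of_mem hA hr, hempty, Set.ncard_empty, add_zero]

theorem copyCount_union_eq_ncard (hA : A.Finite) (hB : B.Finite)
    (hAB : ∀ p ∈ A, ∀ q ∈ B, LeftOf p q) (F : List PlaneTree) :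
    copyCount (A ∪ B) F =
      {x : Set (List ℕ) × Set (List ℕ) |
        (x.1 ⊆ A ∧ x.2 ⊆ B) ∧ shape x.1 ++ shape x.2 = F}.ncard := by
  have hdisj : Disjoint A B := Set.disjoint_left.2 fun p hp hq => (hAB p hp p hq).lt.false
  have hshape : ∀ V ⊆ A, ∀ W ⊆ B, shape (V ∪ W) = shape V ++ shape W := fun V hV W hW =>
    shape_union (hA.subset hV) (hB.subset hW) fun p hp q hq => hAB p (hV hp) q (hW hq)
  refine (Set.ncard_congr (fun x _ => x.1 ∪ x.2) ?_ ?_ ?_).symm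
  · rintro ⟨V, W⟩ ⟨⟨hV, hW⟩, hF⟩
    exact ⟨Set.union_subset_union hV hW, (hshape V hV W hW).trans hF⟩
  · rintro ⟨V, W⟩ ⟨V', W'⟩ ⟨⟨hV, hW⟩, -⟩ ⟨⟨hV', hW'⟩, -⟩ h
    have hleft : ∀ {V W : Set (List ℕ)}, V ⊆ A → W ⊆ B → (V ∪ W) ∩ A = V := fun hV hW => by
      rw [Set.union_inter_distrib_right, Set.inter_eq_left.2 hV,
        (hdisj.mono_right hW).symm.inter_eq, Set.union_empty]
    have hright : ∀ {V W : Set (List ℕ)}, V ⊆ A → W ⊆ B → (V ∪ W) ∩ B = W := fun hV hW => by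
      rw [Set.union_inter_distrib_right, Set.inter_eq_left.2 hW,
        (hdisj.mono_left hV).inter_eq, Set.empty_union]
    dsimp only at hV hW hV' hW' h
    exact Prod.ext (by rw [← hleft hV hW, h, hleft hV' hW'])
      (by rw [← hright hV hW, h, hright hV' hW'])
  · rintro U ⟨hU, hUF⟩
    have hunion : U ∩ A ∪ U ∩ B = U := by
      rw [← Set.inter_union_distrib_left, Set.inter_eq_left.2 hU]
    refine ⟨(U ∩ A, U ∩ B), ⟨⟨Set.inter_subset_right, Set.inter_subset_right⟩, ?_⟩, hunion⟩
    rw [← hshape _ Set.inter_subset_right _ Set.inter_subset_right, hunion, hUF]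

theorem copyCount_union (hA : A.Finite) (hB : B.Finite)
    (hAB : ∀ p ∈ A, ∀ q ∈ B, LeftOf p q) (F : List PlaneTree) :
    copyCount (A ∪ B) F =
      ∑ i ∈ Finset.range (F.length + 1), copyCount A (F.take i) * copyCount B (F.drop i) := by
  have hpairs : {x : Set (List ℕ) × Set (List ℕ) |
      (x.1 ⊆ A ∧ x.2 ⊆ B) ∧ shape x.1 ++ shape x.2 = F} =
      ⋃ i ∈ (Finset.range (F.length + 1) : Set ℕ), copies A (F.take i) ×ˢ copies B (F.drop i) := by
    ext ⟨V, W⟩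
    simp only [Set.mem_ofPred_eq, Set.mem_iUnion, Set.mem_prod, mem_copies, Finset.mem_coe,
      Finset.mem_range, exists_prop]
    constructor
    · rintro ⟨⟨hV, hW⟩, rfl⟩
      exact ⟨(shape V).length, by simp, ⟨hV, by simp⟩, hW, by simp⟩
    · rintro ⟨i, -, ⟨hV, hVF⟩, hW, hWF⟩
      exact ⟨⟨hV, hW⟩, by rw [hVF, hWF, List.take_append_drop]⟩
  have hdisj : (Finset.range (F.length + 1) : Set ℕ).PairwiseDisjoint
      fun i => copies A (F.take i) ×ˢ copies B (F.drop i) := by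
    refine fun i hi j hj hij => Set.disjoint_left.2 fun x hxi hxj => hij ?_
    have hlength := congrArg List.length (hxi.1.2.symm.trans hxj.1.2)
    simp only [Finset.coe_range, Set.mem_Iio] at hi hj
    rwa [List.length_take_of_le (by lia), List.length_take_of_le (by lia)] at hlength
  rw [copyCount_union_eq_ncard hA hB hAB, hpairs, (Finset.finite_toSet _).ncard_biUnion
    (fun i _ => (finite_copies hA _).prod (finite_copies hB _)) hdisj, finsum_mem_coe_finset]
  simp only [Set.ncard_prod, copyCount]

theorem copyCount_forestVertices_pair (L R : PlaneTree) (F : List PlaneTree) :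
    copyCount (forestVertices [L, R]) F = ∑ i ∈ Finset.range (F.length + 1),
      copyCount L.vertices (F.take i) * copyCount R.vertices (F.drop i) := by
  have hL := sameShape_forestVertices_singleton L
  have hR := (preservesShapeOn_shiftRoot 1 _).sameShape_image.symm.trans
    (sameShape_forestVertices_singleton R)
  rw [show [L, R] = [L] ++ [R] from rfl, forestVertices_append, copyCount_union
    (finite_forestVertices _) ((finite_forestVertices _).image _) fun p hp q hq =>
      leftOf_of_mem_forestVertices hp hq]
  simp only [hL.copyCount_eq, List.length_singleton, hR.copyCount_eq]

theorem copyCount_vertices_of_length_ne_one (ts : List PlaneTree) (hF : F.length ≠ 1) :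
    copyCount (node ts).vertices F = copyCount (forestVertices ts) F := by
  rw [← insert_nil_forestVertices, copyCount_insert_of_length_ne_one (finite_forestVertices ts)
    (nil_prefix_and_ne_of_mem_forestVertices ts) hF]

theorem copyCount_vertices_node (ts F : List PlaneTree) :
    copyCount (node ts).vertices [node F] =
      copyCount (forestVertices ts) [node F] + copyCount (forestVertices ts) F := by
  rw [← insert_nil_forestVertices, copyCount_insert_node (finite_forestVertices ts)
    (nil_prefix_and_ne_of_mem_forestVertices ts)]

theorem numEmbeddings_eq_copyCount (T S : PlaneTree) :
    numEmbeddings T S = copyCount T.vertices [S] :=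
  congrArg Set.ncard (Set.ext fun _ => isEmbedding_iff_shape)

theorem numGoodEmbeddings_node (ts F : List PlaneTree) :
    numGoodEmbeddings (node ts) (node F) = copyCount (forestVertices ts) F := by
  rw [← ncard_copies_node_insert_of_mem (finite_forestVertices ts)
    (nil_prefix_and_ne_of_mem_forestVertices ts), insert_nil_forestVertices]
  exact congrArg Set.ncard (Set.ext fun _ => and_congr_left' isEmbedding_iff_shape)

end Copies

section Leaf

variable {A U : Set (List ℕ)}

theorem copyCount_nil (hA : A.Finite) : copyCount A [] = 1 := by
  refine Set.ncard_eq_one.2 ⟨∅, Set.ext fun U => ⟨fun ⟨hU, hshape⟩ => ?_, ?_⟩⟩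
  · obtain ⟨f, -, hf⟩ := hshape ▸ sameShape_shape (hA.subset hU)
    rw [← hf, forestVertices_nil, Set.image_empty, Set.mem_singleton_iff]
  · rintro rfl
    exact ⟨Set.empty_subset A, shape_empty⟩

theorem shape_eq_leaf_iff (hU : U.Finite) : shape U = [node []] ↔ ∃ p, {p} = U := by
  constructor
  · intro h
    obtain ⟨f, -, hf⟩ := h ▸ sameShape_shape hU
    rw [forestVertices_singleton, ← insert_nil_forestVertices, forestVertices_nil,
      insert_empty_eq, Set.image_singleton, Set.image_singleton] at hf
    exact ⟨_, hf⟩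
  · rintro ⟨p, rfl⟩
    rw [← insert_empty_eq, shape_insert Set.finite_empty fun p hp => absurd hp id, shape_empty]

theorem copyCount_leaf (hA : A.Finite) : copyCount A [node []] = A.ncard := by
  have hcopies : copies A [node []] = (fun p => {p}) '' A := by
    ext U
    rw [mem_copies, and_congr_right fun hU => shape_eq_leaf_iff (hA.subset hU)]
    constructor
    · rintro ⟨hU, p, rfl⟩
      exact ⟨p, hU rfl, rfl⟩
    · rintro ⟨p, hp, rfl⟩
      exact ⟨Set.singleton_subset_iff.2 hp, p, rfl⟩
  rw [copyCount, hcopies, Set.ncard_image_of_injective _ Set.singleton_injective]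

theorem ncard_forestVertices (ts : List PlaneTree) :
    (forestVertices ts).ncard = (ts.map fun t => t.vertices.ncard).sum := by
  induction ts with
  | nil => rw [forestVertices_nil, Set.ncard_empty, List.map_nil, List.sum_nil]
  | cons t ts ih =>
    have hdisj : Disjoint (forestVertices [t]) (shiftRoot 1 '' forestVertices ts) :=
      Set.disjoint_left.2 fun p hp hq => (leftOf_of_mem_forestVertices hp hq).lt.false
    rw [List.map_cons, List.sum_cons, ← ih, ← List.singleton_append, forestVertices_append,
      List.length_singleton, Set.ncard_union_eq hdisj (finite_forestVertices _)
        ((finite_forestVertices _).image _),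
      (preservesShapeOn_shiftRoot 1 _).injOn.ncard_image, forestVertices_singleton,
      Set.ncard_image_of_injective _ List.cons_injective]

theorem ncard_vertices (T : PlaneTree) : T.vertices.ncard = T.size := by
  induction T using induction_on_children with
  | node ts ih =>
    rw [← insert_nil_forestVertices, Set.ncard_insert_of_notMem nil_notMem_forestVertices
      (finite_forestVertices ts), ncard_forestVertices, List.map_congr_left ih, size_node, add_comm]

theorem numEmbeddings_leaf (T : PlaneTree) : numEmbeddings T (node []) = T.size := by
  rw [numEmbeddings_eq_copyCount, copyCount_leaf T.vertices_finite, ncard_vertices]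

theorem numGoodEmbeddings_leaf (T : PlaneTree) : numGoodEmbeddings T (node []) = 1 := by
  obtain ⟨ts⟩ := T
  rw [numGoodEmbeddings_node, copyCount_nil (finite_forestVertices ts)]

theorem size_pos (T : PlaneTree) : 0 < T.size := by
  obtain ⟨ts⟩ := T
  rw [size_node]
  lia

theorem degreeCount_zero_pos (T : PlaneTree) : 0 < T.degreeCount 0 := by
  induction T using induction_on_children with
  | node ts ih =>
    rw [degreeCount]
    cases ts with
    | nil => simp
    | cons t ts =>
      rw [List.map_cons, List.sum_cons]
      have := ih t List.mem_cons_self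
      lia

theorem eq_leaf_of_size_eq_one {T : PlaneTree} (h : T.size = 1) : T = node [] := by
  obtain ⟨_ | ⟨t, ts⟩⟩ := T
  · rfl
  · have := t.size_pos
    rw [size_node, List.map_cons, List.sum_cons] at h
    lia

end Leaf

section BinaryTrees

open Finset

variable {T : PlaneTree} {n : ℕ}

theorem mem_binaryTrees : T ∈ binaryTrees n ↔ T.IsBinary ∧ T.size = n :=
  Set.Finite.mem_toFinset _

theorem size_pair (L R : PlaneTree) : (node [L, R]).size = L.size + R.size + 1 := by
  simp only [size_node, List.map_cons, List.map_nil, List.sum_cons, List.sum_nil]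
  lia

theorem IsBinary.odd_size (hT : T.IsBinary) : Odd T.size := by
  induction hT with
  | leaf => simp [size_node]
  | branch L R _ _ hL hR => exact size_pair L R ▸ (hL.add_odd hR).add_one

theorem binaryTrees_one : binaryTrees 1 = {node []} := by
  ext T
  rw [mem_binaryTrees, mem_singleton]
  refine ⟨fun h => eq_leaf_of_size_eq_one h.2, ?_⟩
  rintro rfl
  exact ⟨IsBinary.leaf, by simp [size_node]⟩

theorem sum_binaryTrees_succ {M : Type*} [AddCommMonoid M] (n : ℕ) (w : PlaneTree → M) :
    ∑ T ∈ binaryTrees (2 * (n + 1) + 1), w T = ∑ x ∈ antidiagonal n,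
      ∑ L ∈ binaryTrees (2 * x.1 + 1), ∑ R ∈ binaryTrees (2 * x.2 + 1), w (node [L, R]) := by
  simp only [← sum_product', sum_sigma']
  symm
  refine sum_bij (fun y _ => node [y.2.1, y.2.2]) ?_ ?_ ?_ fun _ _ => rfl
  · rintro ⟨⟨i, j⟩, L, R⟩ h
    simp only [mem_sigma, HasAntidiagonal.mem_antidiagonal, mem_product, mem_binaryTrees] at h
    obtain ⟨rfl, ⟨hL, hLsize⟩, hR, hRsize⟩ := h
    exact mem_binaryTrees.2 ⟨.branch L R hL hR, by rw [size_pair, hLsize, hRsize]; ring⟩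
  · rintro ⟨⟨i, j⟩, L, R⟩ h ⟨⟨i', j'⟩, L', R'⟩ h' heq
    simp only [node.injEq, List.cons.injEq, and_true] at heq
    obtain ⟨rfl, rfl⟩ := heq
    simp only [mem_sigma, HasAntidiagonal.mem_antidiagonal, mem_product, mem_binaryTrees] at h h'
    obtain rfl : i = i' := by lia
    obtain rfl : j = j' := by lia
    rfl
  · intro T hT
    obtain ⟨hT, hsize⟩ := mem_binaryTrees.1 hT
    cases hT with
    | leaf => exact absurd hsize (by simp [size_node])
    | branch L R hL hR =>
      obtain ⟨i, hi⟩ := hL.odd_size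
      obtain ⟨j, hj⟩ := hR.odd_size
      refine ⟨⟨(i, j), L, R⟩, ?_, rfl⟩
      rw [size_pair] at hsize
      simp only [mem_sigma, HasAntidiagonal.mem_antidiagonal, mem_product, mem_binaryTrees]
      exact ⟨by lia, ⟨hL, hi⟩, hR, hj⟩

theorem binaryTrees_nonempty (hn : Odd n) : (binaryTrees n).Nonempty := by
  obtain ⟨n, rfl⟩ := hn
  induction n with
  | zero => exact ⟨node [], by simp [binaryTrees_one]⟩
  | succ n ih =>
    obtain ⟨T, hT⟩ := ih
    obtain ⟨hT, hsize⟩ := mem_binaryTrees.1 hT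
    refine ⟨node [node [], T], mem_binaryTrees.2 ⟨.branch _ _ .leaf hT, ?_⟩⟩
    rw [size_pair, hsize, eq_comm]
    simp only [size_node, List.map_nil, List.sum_nil]
    ring

theorem allCount_leaf (n : ℕ) : allCount n (node []) = #(binaryTrees n) * n := by
  rw [allCount, sum_congr rfl fun T hT => (numEmbeddings_leaf T).trans (mem_binaryTrees.1 hT).2,
    sum_const, smul_eq_mul]

theorem goodCount_leaf (n : ℕ) : goodCount n (node []) = #(binaryTrees n) := by
  rw [goodCount, sum_congr rfl fun T _ => numGoodEmbeddings_leaf T, card_eq_sum_ones]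

end BinaryTrees

section GeneratingFunctions

open PowerSeries

local notation "P" => negBinomialSeries (4 : ℝ)

variable {F : List PlaneTree}

/-- The generating function `∑ₙ (∑ w T) Xⁿ`, the inner sum over the binary trees `T` with `2n + 1`
vertices, that is, with `n` internal vertices. -/
noncomputable def weightSeries {R : Type*} [CommSemiring R] (w : PlaneTree → R) : R⟦X⟧ :=
  mk fun n => ∑ T ∈ binaryTrees (2 * n + 1), w T

theorem weightSeries_eq_of_branch {R ι : Type*} [CommSemiring R] {s : Finset ι} {w : PlaneTree → R}
    {u v : ι → PlaneTree → R} (h : ∀ L R, w (node [L, R]) = ∑ i ∈ s, u i L * v i R) :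
    weightSeries w =
      C (w (node [])) + X * ∑ i ∈ s, weightSeries (u i) * weightSeries (v i) := by
  ext (_ | n)
  · simp [weightSeries, binaryTrees_one]
  · rw [map_add, coeff_C, if_neg n.succ_ne_zero, zero_add, coeff_succ_X_mul, map_sum, weightSeries,
      coeff_mk, sum_binaryTrees_succ]
    simp only [weightSeries, coeff_mul, coeff_mk, h, Finset.sum_mul_sum]
    rw [Finset.sum_comm]
    refine Finset.sum_congr rfl fun x _ => ?_
    rw [Finset.sum_comm_cycle]

/-- The generating function of the copies of the forest `F` in binary trees. -/
noncomputable def copySeries (F : List PlaneTree) : ℝ⟦X⟧ :=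
  weightSeries fun T => (copyCount T.vertices F : ℝ)

/-- The generating function of the copies of the forest `F` in binary trees that avoid the root. -/
noncomputable def rootlessCopySeries (F : List PlaneTree) : ℝ⟦X⟧ :=
  weightSeries fun T => (copyCount (T.vertices \ {[]}) F : ℝ)

theorem coeff_copySeries_singleton (S : PlaneTree) (n : ℕ) :
    coeff n (copySeries [S]) = allCount (2 * n + 1) S := by
  simp only [copySeries, weightSeries, coeff_mk, allCount, numEmbeddings_eq_copyCount,
    Nat.cast_sum]

theorem coeff_rootlessCopySeries (F : List PlaneTree) (n : ℕ) :
    coeff n (rootlessCopySeries F) = goodCount (2 * n + 1) (node F) := by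
  rw [rootlessCopySeries, weightSeries, coeff_mk, goodCount, Nat.cast_sum]
  exact Finset.sum_congr rfl fun ⟨ts⟩ _ => congrArg _ (numGoodEmbeddings_node ts F).symm

theorem copySeries_of_length_ne_one (hF : F.length ≠ 1) : copySeries F = rootlessCopySeries F :=
  congrArg weightSeries <| funext fun ⟨ts⟩ =>
    congrArg Nat.cast (copyCount_vertices_of_length_ne_one ts hF)

theorem copySeries_node (F : List PlaneTree) :
    copySeries [node F] = rootlessCopySeries [node F] + rootlessCopySeries F := by
  ext n
  simp only [copySeries, rootlessCopySeries, weightSeries, map_add, coeff_mk,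
    ← Finset.sum_add_distrib, ← Nat.cast_add]
  exact Finset.sum_congr rfl fun ⟨ts⟩ _ => congrArg _ (copyCount_vertices_node ts F)

theorem rootlessCopySeries_eq [Decidable (F = [])] :
    rootlessCopySeries F = C (if F = [] then 1 else 0) +
      X * ∑ i ∈ Finset.range (F.length + 1), copySeries (F.take i) * copySeries (F.drop i) := by
  have hleaf : (node []).vertices \ {[]} = ∅ := forestVertices_nil
  have hbranch : ∀ L R : PlaneTree, (copyCount ((node [L, R]).vertices \ {[]}) F : ℝ) =
      ∑ i ∈ Finset.range (F.length + 1),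
        (copyCount L.vertices (F.take i) : ℝ) * copyCount R.vertices (F.drop i) := fun L R =>
    mod_cast copyCount_forestVertices_pair L R F
  rw [rootlessCopySeries, weightSeries_eq_of_branch hbranch, hleaf, copyCount_empty, Nat.cast_ite,
    Nat.cast_one, Nat.cast_zero]
  rfl

theorem copySeries_nil : copySeries [] = 1 + X * copySeries [] ^ 2 := by
  conv_lhs => rw [copySeries_of_length_ne_one (by simp), rootlessCopySeries_eq]
  simp [sq]

theorem one_sub_two_mul_X_mul_copySeries_nil : 1 - 2 * (X * copySeries []) = P (-1 / 2) := by
  refine powerSeries_eq_of_sq_eq_sq ?_ ?_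
  · have hsq : P (-1 / 2) ^ 2 = 1 - 4 * X := by
      rw [sq, ← negBinomialSeries_add, add_halves, negBinomialSeries_neg_one, map_ofNat]
    rw [hsq]
    linear_combination -4 * X * copySeries_nil
  · rw [constantCoeff_negBinomialSeries, map_sub, map_one, map_mul, map_mul, constantCoeff_X]
    norm_num

theorem rootlessCopySeries_of_ne_nil (hF : F ≠ []) :
    rootlessCopySeries F = (1 - P (-1 / 2)) * copySeries F +
      X * ∑ i ∈ Finset.range (F.length - 1),
        copySeries (F.take (i + 1)) * copySeries (F.drop (i + 1)) := by
  classical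
  obtain ⟨n, hn⟩ := Nat.exists_eq_succ_of_ne_zero (mt List.length_eq_zero_iff.1 hF)
  rw [rootlessCopySeries_eq, if_neg hF, map_zero, zero_add, Finset.sum_range_succ', hn,
    Finset.sum_range_succ, ← Nat.succ_eq_add_one n, ← hn, List.take_length, List.drop_length,
    List.take_zero, List.drop_zero, ← one_sub_two_mul_X_mul_copySeries_nil, hn, Nat.succ_sub_one]
  ring

theorem rootlessCopySeries_singleton (S : PlaneTree) :
    rootlessCopySeries [S] = (1 - P (-1 / 2)) * copySeries [S] := by
  rw [rootlessCopySeries_of_ne_nil (List.cons_ne_nil S []), List.length_singleton, Nat.sub_self,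
    Finset.sum_range_zero, mul_zero, add_zero]

theorem sqrt_mul_copySeries_node (F : List PlaneTree) :
    P (-1 / 2) * copySeries [node F] = rootlessCopySeries F := by
  linear_combination copySeries_node F + rootlessCopySeries_singleton (node F)

theorem sqrt_mul_copySeries_of_two_le (hF : 2 ≤ F.length) :
    P (-1 / 2) * copySeries F = X * ∑ i ∈ Finset.range (F.length - 1),
      copySeries (F.take (i + 1)) * copySeries (F.drop (i + 1)) := by
  have hne : F ≠ [] := List.ne_nil_of_length_pos (by lia)
  linear_combination
    copySeries_of_length_ne_one (F := F) (by lia) + rootlessCopySeries_of_ne_nil hne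

/-- The normalization of the generating function of the copies of `F` in binary trees for which the
recursion over the splittings of `F` has no factors. -/
noncomputable def normalizedCopySeries (F : List PlaneTree) : ℝ⟦X⟧ :=
  P (1 / 2) * (X * copySeries F)

theorem invSqrt_mul_sqrt : P (1 / 2) * P (-1 / 2) = 1 := by
  rw [← negBinomialSeries_add, ← negBinomialSeries_zero (4 : ℝ)]
  norm_num

theorem sqrt_mul_normalizedCopySeries (F : List PlaneTree) :
    P (-1 / 2) * normalizedCopySeries F = X * copySeries F := by
  rw [normalizedCopySeries]
  linear_combination X * copySeries F * invSqrt_mul_sqrt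

theorem normalizedCopySeries_eq_sum_splits (hF : 2 ≤ F.length) :
    normalizedCopySeries F = ∑ i ∈ Finset.range (F.length - 1),
      normalizedCopySeries (F.take (i + 1)) * normalizedCopySeries (F.drop (i + 1)) := by
  have hfactor : ∀ G H : List PlaneTree, normalizedCopySeries G * normalizedCopySeries H =
      P (1 / 2) ^ 2 * X ^ 2 * (copySeries G * copySeries H) := fun G H => by
    rw [normalizedCopySeries, normalizedCopySeries]
    ring
  simp only [hfactor, ← Finset.mul_sum]
  rw [normalizedCopySeries]
  linear_combination P (1 / 2) ^ 2 * X * sqrt_mul_copySeries_of_two_le hF -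
    P (1 / 2) * X * copySeries F * invSqrt_mul_sqrt

theorem normalizedCopySeries_node (F : List PlaneTree) :
    normalizedCopySeries [node F] = P (1 / 2) ^ 2 * (X * rootlessCopySeries F) := by
  rw [normalizedCopySeries]
  linear_combination P (1 / 2) ^ 2 * X * sqrt_mul_copySeries_node F -
    P (1 / 2) * X * copySeries [node F] * invSqrt_mul_sqrt

theorem normalizedCopySeries_leaf :
    normalizedCopySeries [node []] = C (1 / 2) * (1 - P (-1 / 2)) * P 1 := by
  have hhalf : C (1 / 2 : ℝ) * 2 = 1 := by
    rw [← map_ofNat C 2, ← map_mul, one_div_mul_cancel two_ne_zero, map_one]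
  rw [normalizedCopySeries_node, ← copySeries_of_length_ne_one (by simp), sq,
    ← negBinomialSeries_add, add_halves, ← one_sub_two_mul_X_mul_copySeries_nil]
  linear_combination -P 1 * (X * copySeries []) * hhalf

theorem normalizedCopySeries_node_singleton (S : PlaneTree) :
    normalizedCopySeries [node [S]] =
      (1 - P (-1 / 2)) * P (1 / 2) * normalizedCopySeries [S] := by
  rw [normalizedCopySeries_node, rootlessCopySeries_singleton, normalizedCopySeries]
  ring

theorem normalizedCopySeries_node_of_two_le (hF : 2 ≤ F.length) :
    normalizedCopySeries [node F] = C (catalan (F.length - 1) : ℝ) * P (1 / 2) *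
      (F.map fun S => normalizedCopySeries [S]).prod := by
  have hprod := eq_catalan_mul_prod_of_eq_sum_splits
    (fun _ => normalizedCopySeries_eq_sum_splits) (List.ne_nil_of_length_pos (l := F) (by lia))
  rw [normalizedCopySeries_node, ← copySeries_of_length_ne_one (by lia), map_natCast,
    mul_right_comm, ← hprod, normalizedCopySeries]
  ring

/-- The exponent of `1 / (1 - 4X)` in `normalizedCopySeries [S]`. -/
noncomputable def singularExponent (S : PlaneTree) : ℝ := (S.size + S.degreeCount 0) / 2

theorem singularExponent_node [Decidable (F = [])] :
    (node F).singularExponent =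
      (if F = [] then 1 else 1 / 2) + (F.map singularExponent).sum := by
  have hsum : (F.map singularExponent).sum =
      ((F.map size).sum + (F.map (degreeCount 0)).sum : ℕ) / 2 := by
    induction F with
    | nil => simp
    | cons S F ih =>
      simp only [List.map_cons, List.sum_cons, ih, singularExponent]
      push_cast
      ring
  rw [hsum, singularExponent, size_node, degreeCount]
  simp only [List.length_eq_zero_iff]
  split_ifs <;> push_cast <;> ring

theorem hasSingularExponent_normalizedCopySeries (S : PlaneTree) :
    HasSingularExponent 4 (normalizedCopySeries [S]) S.singularExponent := by
  classical
  induction S using induction_on_children with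
  | node F ih =>
    have hsqrt := hasSingularExponent_one_sub_sqrt 4
    have hpole := hasSingularExponent_negBinomialSeries 4
    rw [singularExponent_node]
    match F with
    | [] =>
      rw [normalizedCopySeries_leaf]
      simpa using ((hasSingularExponent_C 4 one_half_pos).mul hsqrt).mul (hpole 1)
    | [S] =>
      rw [normalizedCopySeries_node_singleton]
      simpa using (hsqrt.mul (hpole (1 / 2))).mul (ih S (List.mem_singleton_self S))
    | S :: S' :: F =>
      rw [normalizedCopySeries_node_of_two_le (by simp)]
      have hcatalan := hasSingularExponent_C 4 (Nat.cast_pos.2 (catalan_pos (F.length + 1)))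
      simpa using (hcatalan.mul (hpole (1 / 2))).mul (HasSingularExponent.list_prod ih)

theorem tendsto_goodCount_div_allCount_mul_sqrt {S : PlaneTree} (hS : 1 < S.singularExponent) :
    Tendsto (fun n : ℕ => (goodCount (2 * n + 1) S : ℝ) / allCount (2 * n + 1) S * √(n + 1)) atTop
      (𝓝 (Real.Gamma (S.singularExponent - 1 / 2) /
        Real.Gamma (S.singularExponent - 1))) := by
  obtain ⟨F⟩ := S
  have hall : HasSingularExponent 4 (X * copySeries [node F])
      ((node F).singularExponent - 1 / 2) := by
    have := (hasSingularExponent_negBinomialSeries 4 (-1 / 2)).mul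
      (hasSingularExponent_normalizedCopySeries (node F))
    rwa [sqrt_mul_normalizedCopySeries, neg_div, neg_add_eq_sub] at this
  have hlim := (hall.tendsto_coeff_sqrt_mul_div_coeff four_ne_zero (by linarith)).comp
    (tendsto_add_atTop_nat 1)
  rw [sub_sub, add_halves] at hlim
  refine hlim.congr fun n => ?_
  rw [Function.comp_apply, mul_left_comm, sqrt_mul_copySeries_node, coeff_succ_X_mul,
    coeff_succ_X_mul, coeff_copySeries_singleton, coeff_rootlessCopySeries, Nat.cast_succ]

theorem eq_leaf_of_singularExponent_eq_one {S : PlaneTree} (h : S.singularExponent = 1) :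
    S = node [] := by
  have hsum : S.size + S.degreeCount 0 = 2 := by
    rw [singularExponent, div_eq_one_iff_eq two_ne_zero] at h
    exact_mod_cast h
  have := S.size_pos
  have := S.degreeCount_zero_pos
  exact eq_leaf_of_size_eq_one (by lia)

theorem goodCount_leaf_div_allCount_leaf {n : ℕ} (hn : Odd n) :
    (goodCount n (node []) : ℝ) / allCount n (node []) = 1 / n := by
  have hcard : ((binaryTrees n).card : ℝ) ≠ 0 :=
    Nat.cast_ne_zero.2 (binaryTrees_nonempty hn).card_ne_zero
  rw [goodCount_leaf, allCount_leaf, Nat.cast_mul, ← div_div, div_self hcard]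

end GeneratingFunctions

end PlaneTree

theorem mainTheorem4 (S : PlaneTree) (m l : ℕ) (hm : m = S.size) (hl : l = S.degreeCount 0)
    (k : ℝ) (hk : k = ((m : ℝ) + (l : ℝ) - 2) / 2) :
    (0 < k →
      ((fun n : ℕ => (PlaneTree.goodCount n S : ℝ) / (PlaneTree.allCount n S : ℝ))
          ~[atTop ⊓ 𝓟 {n : ℕ | Odd n}]
        fun n : ℕ => Real.Gamma (k + 1 / 2) / Real.Gamma k * (√2 / √(n : ℝ))) ∧
      ((fun n : ℕ => (PlaneTree.goodCount n S : ℝ) / (PlaneTree.allCount n S : ℝ))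
          =Θ[atTop ⊓ 𝓟 {n : ℕ | Odd n}]
        fun n : ℕ => 1 / √(n : ℝ))) ∧
    (k = 0 →
      (fun n : ℕ => (PlaneTree.goodCount n S : ℝ) / (PlaneTree.allCount n S : ℝ))
          ~[atTop ⊓ 𝓟 {n : ℕ | Odd n}]
        fun n : ℕ => 1 / (n : ℝ)) := by
  have hexp : S.singularExponent = k + 1 := by
    rw [PlaneTree.singularExponent, hk, hm, hl]
    ring
  constructor
  · intro hk0
    have hGamma : Real.Gamma (k + 1 / 2) / Real.Gamma k ≠ 0 :=
      (div_pos (Real.Gamma_pos_of_pos (by linarith)) (Real.Gamma_pos_of_pos hk0)).ne'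
    have hlim := PlaneTree.tendsto_goodCount_div_allCount_mul_sqrt (S := S) (by linarith)
    rw [hexp, add_sub_assoc, add_sub_assoc, sub_self, add_zero, sub_half] at hlim
    have hequiv := isEquivalent_const_mul_sqrt_two_div_sqrt
      (f := fun n => (PlaneTree.goodCount n S : ℝ) / PlaneTree.allCount n S) hGamma hlim
    exact ⟨hequiv, hequiv.isTheta.trans (isTheta_const_mul_const_div _ hGamma (by positivity))⟩
  · rintro rfl
    obtain rfl := PlaneTree.eq_leaf_of_singularExponent_eq_one (hexp.trans (zero_add 1))
    exact EventuallyEq.isEquivalent <| eventually_inf_principal.2 <| .of_forall fun _ hn =>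
      PlaneTree.goodCount_leaf_div_allCount_leaf hn
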